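/- Let $M$ single-frequency-network (SFN) base stations with transmission powers $P_i>0$ lie at distances $d_{S,i}>0$ from a receiver at the origin of $\mathbb R^2$. Interfering base stations form a homogeneous Poisson point process $\Phi$ in the plane with intensity $\lambda_I>0$; each of them transmits with power $P_I>0$ and, independently, is in line of sight with probability $p_L\in[0,1]$ and not in line of sight with probability $p_N=1-p_L$. Let $\alpha_L,\alpha_N\ge 2$ be the path loss exponents; the path loss of an interferer $j$ at distance $d_{I,j}$ is $\ell_j=d_{I,j}^{-\alpha_L}$ if it is in line of sight and $\ell_j=d_{I,j}^{-\alpha_N}$ otherwise, and that of the $i$-th SFN base station is $d_{S,i}^{-\alpha_L}$. All fading coefficients ($h_i$ of the SFN base stations, $h'_j$ of the interferers) are exponential with mean $1$; they, the line-of-sight marks and $\Phi$ are mutually independent. With transmission gains $G_S,G_I>0$ of the SFN base stations and of the interferers, receiving gain $G_{RX}>0$ and thermal noise power $W\ge 0$, put $$I=G_I G_{RX}P_I\sum_{j\in\Phi}h'_j\,\ell_j,\qquad \mathrm{SINR}=\frac{G_S G_{RX}\sum_{i=1}^M P_i h_i d_{S,i}^{-\alpha_L}}{W+I},\qquad P_T(\theta)=\mathbb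 P[\mathrm{SINR}<\theta],$$ and let $\mathcal L_I(s)=\mathbb E[e^{-sI}]$, $s>0$, be the Laplace transform of $I$ (with $e^{-\infty}=0$). Suppose that the means $\mu_i=P_i d_{S,i}^{-\alpha_L}$, $i=1,\dots,M$, are pairwise distinct. Then for every threshold $\theta>0$ $$P_T(\theta)=1-\Big(\prod_{j=1}^M\mu_j^{-1}\Big)\sum_{k=1}^M\hat D_k\,\mathcal L_I\!\left(\frac{\mu_k^{-1}\theta}{G_S G_{RX}}\right),\qquad \hat D_k=\mu_k\,e^{-\frac{\mu_k^{-1}\theta W}{G_S G_{RX}}}\prod_{j\ne k}\Big(\frac1{\mu_j}-\frac1{\mu_k}\Big)^{-1}.$$ Moreover, if $\alpha_L,\alpha_N>2$, then for every $s>0$ $$\mathcal L_I(s)=\prod_{X\in\{L,N\}}\exp\left(-\frac{2\,p_X\lambda_I\,\pi^2\,(G_I G_{RX}P_I)^{2/\alpha_X}\,s^{2/\alpha_X}}{\alpha_X\sin(2\pi/\alpha_X)}\right).$$ -/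

import Mathlib

open MeasureTheory ProbabilityTheory
open scoped ENNReal NNReal BigOperators

noncomputable section

/-- The Euclidean plane in which the base stations are located. -/
abbrev Plane : Type := EuclideanSpace ℝ (Fin 2)

/-- Number of indices `j` with `X j ω ∈ B`, for a random sequence of points `X`. -/
def pointCount {Ω : Type*} (X : ℕ → Ω → Plane) (B : Set Plane) (ω : Ω) : ℝ≥0∞ :=
  ∑' j, B.indicator (fun _ => (1 : ℝ≥0∞)) (X j ω)

/-- The random points `X 0, X 1, …` form a homogeneous Poisson point process with intensity `lam`
in the plane (for `lam > 0` such a process has almost surely infinitely many points, so that its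
points can be enumerated by `ℕ`): the number of points in a Borel set `B` of finite area is Poisson
distributed with mean `lam * area B`, and the numbers of points in finitely many pairwise disjoint
such sets are independent. -/
structure IsPoissonProcess {Ω : Type*} [MeasurableSpace Ω] (Pr : Measure Ω)
    (X : ℕ → Ω → Plane) (lam : ℝ) : Prop where
  measurable : ∀ j, Measurable (X j)
  law : ∀ B : Set Plane, MeasurableSet B → volume B ≠ ∞ →
    Pr.map (pointCount X B) =
      (poissonMeasure (Real.toNNReal lam * (volume B).toNNReal)).map (fun n : ℕ => (n : ℝ≥0∞))
  indep : ∀ (n : ℕ) (B : Fin n → Set Plane), (∀ i, MeasurableSet (B i)) →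
    (∀ i, volume (B i) ≠ ∞) → Pairwise (fun i j => Disjoint (B i) (B j)) →
    iIndepFun (fun i => pointCount X (B i)) Pr

/-- The deterministic parameters: `M` SFN base stations at distances `d i` from the origin with
transmission powers `P i`, and interfering base stations of intensity `lam` with power `PI`. -/
structure SFNParams (M : ℕ) where
  /-- transmission powers of the SFN base stations -/
  P : Fin M → ℝ
  /-- distances of the SFN base stations from the receiver -/
  d : Fin M → ℝ
  /-- transmission power of the interfering base stations -/
  PI : ℝ
  /-- transmission gain of the SFN base stations -/
  GS : ℝ
  /-- transmission gain of the interfering base stations -/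
  GI : ℝ
  /-- receiving gain -/
  GR : ℝ
  /-- thermal noise power -/
  W : ℝ
  /-- intensity of the interfering base stations -/
  lam : ℝ
  /-- probability that an interfering base station is in line of sight -/
  pL : ℝ
  /-- line-of-sight path loss exponent -/
  αL : ℝ
  /-- non-line-of-sight path loss exponent -/
  αN : ℝ
  P_pos : ∀ i, 0 < P i
  d_pos : ∀ i, 0 < d i
  PI_pos : 0 < PI
  GS_pos : 0 < GS
  GI_pos : 0 < GI
  GR_pos : 0 < GR
  W_nonneg : 0 ≤ W
  lam_pos : 0 < lam
  pL_nonneg : 0 ≤ pL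
  pL_le_one : pL ≤ 1
  two_le_αL : 2 ≤ αL
  two_le_αN : 2 ≤ αN

/-- The random objects: the interfering base stations are at the points `X j` of a Poisson process;
`los j` says whether the `j`-th one is in line of sight; `h j` is its fading coefficient, and `g i`
is the fading coefficient of the `i`-th SFN base station. All fading coefficients are exponential
with mean `1`, and everything is independent. -/
structure IsSFNNetwork {Ω : Type*} [MeasurableSpace Ω] {M : ℕ} (N : SFNParams M) (Pr : Measure Ω)
    (X : ℕ → Ω → Plane) (los : ℕ → Ω → Bool) (h : ℕ → Ω → ℝ) (g : Fin M → Ω → ℝ) : Prop where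
  poisson : IsPoissonProcess Pr X N.lam
  los_measurable : ∀ j, Measurable (los j)
  h_measurable : ∀ j, Measurable (h j)
  g_measurable : ∀ i, Measurable (g i)
  los_law : ∀ j, Pr {ω | los j ω = true} = ENNReal.ofReal N.pL
  h_law : ∀ j, Pr.map (h j) = expMeasure 1
  g_law : ∀ i, Pr.map (g i) = expMeasure 1
  los_indep : iIndepFun los Pr
  h_indep : iIndepFun h Pr
  g_indep : iIndepFun g Pr
  /- The four families are mutually independent. -/
  indep_points : IndepFun (fun ω j => X j ω)
    (fun ω => ((fun j => los j ω), (fun j => h j ω), (fun i => g i ω))) Pr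
  indep_los : IndepFun (fun ω j => los j ω)
    (fun ω => ((fun j => h j ω), (fun i => g i ω))) Pr
  indep_fading : IndepFun (fun ω j => h j ω) (fun ω i => g i ω) Pr

namespace SFNParams

variable {Ω : Type*} {M : ℕ}

/-- Path loss of an interfering base station at distance `r`. -/
def pathLoss (N : SFNParams M) (isLOS : Bool) (r : ℝ) : ℝ :=
  if isLOS then r ^ (-N.αL) else r ^ (-N.αN)

/-- The mean received power `μ i = P i * (d i) ^ (-αL)` of the `i`-th SFN base station. -/
def mu (N : SFNParams M) (i : Fin M) : ℝ := N.P i * N.d i ^ (-N.αL)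

/-- The interference power at the origin, with values in `[0, ∞]`. -/
def interference (N : SFNParams M) (X : ℕ → Ω → Plane) (los : ℕ → Ω → Bool) (h : ℕ → Ω → ℝ)
    (ω : Ω) : ℝ≥0∞ :=
  ENNReal.ofReal (N.GI * N.GR * N.PI) *
    ∑' j, ENNReal.ofReal (h j ω * N.pathLoss (los j ω) ‖X j ω‖)

/-- The signal-to-interference-plus-noise ratio at the origin (zero if the interference is
infinite). -/
def sinr (N : SFNParams M) (X : ℕ → Ω → Plane) (los : ℕ → Ω → Bool) (h : ℕ → Ω → ℝ)
    (g : Fin M → Ω → ℝ) (ω : Ω) : ℝ≥0∞ :=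
  ENNReal.ofReal (N.GS * N.GR * ∑ i, N.P i * g i ω * N.d i ^ (-N.αL)) /
    (ENNReal.ofReal N.W + N.interference X los h ω)

/-- The outage probability: the probability that the SINR is smaller than `θ`. -/
def outageProb [MeasurableSpace Ω] (N : SFNParams M) (Pr : Measure Ω) (X : ℕ → Ω → Plane)
    (los : ℕ → Ω → Bool) (h : ℕ → Ω → ℝ) (g : Fin M → Ω → ℝ) (θ : ℝ) : ℝ :=
  Pr.real {ω | N.sinr X los h g ω < ENNReal.ofReal θ}

/-- The coefficient `D̂ k`. -/
def Dhat (N : SFNParams M) (θ : ℝ) (k : Fin M) : ℝ :=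
  N.mu k * Real.exp (-((N.mu k)⁻¹ * θ * N.W / (N.GS * N.GR))) *
    ∏ j ∈ Finset.univ.erase k, (1 / N.mu j - 1 / N.mu k)⁻¹

/-- The factor of the Laplace transform of the interference that is due to the base stations with
path loss exponent `α` and intensity `lamX`, in closed form (for `α > 2`). -/
def laplaceFactor (N : SFNParams M) (lamX α s : ℝ) : ℝ :=
  Real.exp (-(2 * lamX * Real.pi ^ 2 * (N.GI * N.GR * N.PI) ^ (2 / α) * s ^ (2 / α) /
    (α * Real.sin (2 * Real.pi / α))))

end SFNParams

/-- Laplace transform `E[exp (-s I)]` at `s > 0` of a random variable `I` with values in `[0, ∞]`,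
where `exp (-∞) = 0`. -/
def laplaceTransform {Ω : Type*} [MeasurableSpace Ω] (Pr : Measure Ω) (I : Ω → ℝ≥0∞) (s : ℝ) : ℝ :=
  ∫ ω, (if I ω = ∞ then 0 else Real.exp (-(s * (I ω).toReal))) ∂Pr

end

/-! Write `S = ∑ μ_i g_i`, so that up to a null set `SINR ≥ θ` means `S ≥ θ (W + I) / (G_S G_R)`. As
a sum of independent exponentials with distinct means, `S` has tail `P(S ≥ x) = ∑ c_k exp (-x /
μ_k)` with `c_k = ∏_{j ≠ k} μ_k / (μ_k - μ_j)` (`measureReal_le_sum_mul`). `I` is independent of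
`S`, so averaging this tail at `x = θ (W + I) / (G_S G_R)` turns each exponential into a noise
factor times a value of the Laplace transform of `I`. The tail follows by induction on the number of
summands; the coefficient of the new exponential comes from `∑ c_k = 1`, a Lagrange interpolation
identity at the nodes `1 / μ_k`.

For the closed form, fix the points. Fading and marks are independent, so the conditional
expectation of `exp (-s I)` is a product `∏ φ(‖X_j‖)`, where `φ` is a mixture of terms `1 / (1 + t r
^ (-α))`. This is the exponential of minus the sum of `-log φ` over the points, and the Laplace
functional of the Poisson process (`IsPoissonProcess.lintegral_expNeg_tsum`) gives `exp (-λ ∫ (1 -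
φ))`. Polar coordinates and a Beta integral evaluate the exponent (`lintegral_plane_pathLoss`).

Since `expNeg` is continuous on `[0, ∞]` and bounded by `1`, infinite sums and infinite interference
pass through limits without separate treatment. -/

/-! ### The exponential `exp (-x)` on `[0, ∞]` -/

/-- The function `x ↦ exp (-x)` on `[0, ∞]`, with `exp (-∞) = 0`. -/
noncomputable def expNeg (x : ℝ≥0∞) : ℝ≥0∞ := EReal.exp (-(x : EReal))

@[simp] lemma expNeg_zero : expNeg 0 = 1 := by simp [expNeg]

@[simp] lemma expNeg_top : expNeg ∞ = 0 := by simp [expNeg]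

lemma expNeg_ofReal {x : ℝ} (hx : 0 ≤ x) :
    expNeg (ENNReal.ofReal x) = ENNReal.ofReal (Real.exp (-x)) := by
  rw [expNeg, EReal.coe_ennreal_ofReal, max_eq_left hx, ← EReal.coe_neg, EReal.exp_coe]

lemma continuous_expNeg : Continuous expNeg :=
  ENNReal.continuous_exp.comp (continuous_neg.comp continuous_coe_ennreal_ereal)

@[fun_prop] lemma measurable_expNeg : Measurable expNeg := continuous_expNeg.measurable

lemma antitone_expNeg : Antitone expNeg := fun x y hxy =>
  EReal.exp_monotone (EReal.neg_le_neg_iff.2 (by exact_mod_cast hxy))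

lemma expNeg_le_one (x : ℝ≥0∞) : expNeg x ≤ 1 := by
  simpa using antitone_expNeg (zero_le (a := x))

lemma expNeg_ne_top (x : ℝ≥0∞) : expNeg x ≠ ∞ :=
  ((expNeg_le_one x).trans_lt ENNReal.one_lt_top).ne

lemma expNeg_add (x y : ℝ≥0∞) : expNeg (x + y) = expNeg x * expNeg y := by
  rcases eq_or_ne x ∞ with rfl | hx
  · simp
  rcases eq_or_ne y ∞ with rfl | hy
  · simp
  rw [← ENNReal.ofReal_toReal hx, ← ENNReal.ofReal_toReal hy,
    ← ENNReal.ofReal_add ENNReal.toReal_nonneg ENNReal.toReal_nonneg,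
    expNeg_ofReal ENNReal.toReal_nonneg, expNeg_ofReal ENNReal.toReal_nonneg,
    expNeg_ofReal (add_nonneg ENNReal.toReal_nonneg ENNReal.toReal_nonneg), neg_add, Real.exp_add,
    ENNReal.ofReal_mul (Real.exp_pos _).le]

lemma expNeg_sum {ι : Type*} (s : Finset ι) (f : ι → ℝ≥0∞) :
    expNeg (∑ i ∈ s, f i) = ∏ i ∈ s, expNeg (f i) := by
  induction s using Finset.cons_induction with
  | empty => simp
  | cons a s ha ih => rw [Finset.sum_cons, Finset.prod_cons, expNeg_add, ih]

lemma expNeg_mul_natCast (a : ℝ≥0∞) (n : ℕ) : expNeg (a * n) = expNeg a ^ n := by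
  induction n with
  | zero => simp
  | succ n ih => rw [Nat.cast_succ, mul_add, mul_one, expNeg_add, ih, pow_succ]

/-- This turns a product over the points into `expNeg` of a sum, the form to which the Laplace
functional applies. -/
lemma expNeg_ofReal_neg_log {x : ℝ} (h0 : 0 < x) (h1 : x ≤ 1) :
    expNeg (ENNReal.ofReal (-Real.log x)) = ENNReal.ofReal x := by
  rw [expNeg_ofReal (by have := Real.log_nonpos h0.le h1; linarith), neg_neg, Real.exp_log h0]

/-- Positivity of `s` gives `s * ∞ = ∞`, so the value `0` prescribed at infinite `I` agrees with
`expNeg ∞`. -/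
lemma laplaceTransform_eq_toReal {Ω : Type*} [MeasurableSpace Ω] (Pr : Measure Ω) {I : Ω → ℝ≥0∞}
    (hI : Measurable I) {s : ℝ} (hs : 0 < s) :
    laplaceTransform Pr I s = (∫⁻ ω, expNeg (ENNReal.ofReal s * I ω) ∂Pr).toReal := by
  rw [laplaceTransform, ← integral_toReal (by fun_prop)
    (Filter.Eventually.of_forall fun ω => (expNeg_ne_top _).lt_top)]
  refine integral_congr_ae (Filter.Eventually.of_forall fun ω => ?_)
  dsimp only
  split_ifs with h
  · simp [h, ENNReal.mul_top, hs]
  · rw [← ENNReal.ofReal_toReal h, ← ENNReal.ofReal_mul hs.le,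
      expNeg_ofReal (mul_nonneg hs.le ENNReal.toReal_nonneg),
      ENNReal.toReal_ofReal (Real.exp_pos _).le, ENNReal.toReal_ofReal ENNReal.toReal_nonneg]

/-- Dominated convergence for `expNeg` of a pointwise convergent sequence. -/
lemma tendsto_lintegral_expNeg {Ω : Type*} [MeasurableSpace Ω] (Pr : Measure Ω)
    [IsProbabilityMeasure Pr] {F : ℕ → Ω → ℝ≥0∞} {G : Ω → ℝ≥0∞} (hF : ∀ n, Measurable (F n))
    (hlim : ∀ ω, Filter.Tendsto (fun n => F n ω) Filter.atTop (nhds (G ω))) :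
    Filter.Tendsto (fun n => ∫⁻ ω, expNeg (F n ω) ∂Pr) Filter.atTop
      (nhds (∫⁻ ω, expNeg (G ω) ∂Pr)) := by
  refine tendsto_lintegral_of_dominated_convergence (fun _ => 1)
    (fun n => measurable_expNeg.comp (hF n))
    (fun n => Filter.Eventually.of_forall fun ω => expNeg_le_one _) (by simp)
    (Filter.Eventually.of_forall fun ω => (continuous_expNeg.tendsto _).comp (hlim ω))

/-! ### The Laplace functional of a Poisson process -/

/-- The Laplace transform of the Poisson distribution. -/
lemma lintegral_expNeg_poissonMeasure (r : ℝ≥0) (a : ℝ≥0∞) :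
    ∫⁻ n : ℕ, expNeg (a * n) ∂(poissonMeasure r) = expNeg (r * (1 - expNeg a)) := by
  obtain ⟨q, hq⟩ : ∃ q : ℝ≥0, expNeg a = q := ⟨_, (ENNReal.coe_toNNReal (expNeg_ne_top a)).symm⟩
  have hq1 : (q : ℝ) ≤ 1 := by
    have := expNeg_le_one a
    rw [hq] at this
    exact_mod_cast this
  -- With `q = expNeg a`, the expectation of `q ^ n` is `exp (-r)` times the exponential series at
  -- `r * q`.
  have h1 : ∀ n : ℕ, ENNReal.ofReal (Real.exp (-r) * r ^ n / (n.factorial)) * expNeg (a * n)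
      = ENNReal.ofReal (Real.exp (-r) * ((r * q) ^ n / n.factorial)) := by
    intro n
    rw [expNeg_mul_natCast, hq, ← ENNReal.ofReal_coe_nnreal (p := q), ← ENNReal.ofReal_pow q.coe_nonneg,
      ← ENNReal.ofReal_mul (by positivity)]
    congr 1
    rw [mul_pow]
    ring
  have hs : HasSum (fun n : ℕ => Real.exp (-r) * (((r : ℝ) * q) ^ n / n.factorial))
      (Real.exp (-r) * Real.exp (r * q)) := by
    have := NormedSpace.expSeries_div_hasSum_exp ((r : ℝ) * q)
    rw [← Real.exp_eq_exp_ℝ] at this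
    exact this.mul_left _
  rw [poissonMeasure, lintegral_sum_measure]
  simp_rw [lintegral_smul_measure, lintegral_dirac, smul_eq_mul, h1]
  rw [← ENNReal.ofReal_tsum_of_nonneg (fun n => by positivity) hs.summable, hs.tsum_eq, hq,
    ← Real.exp_add]
  have h2 : (r : ℝ≥0∞) * (1 - (q : ℝ≥0∞)) = ENNReal.ofReal (r * (1 - q)) := by
    rw [ENNReal.ofReal_mul r.coe_nonneg, ENNReal.ofReal_coe_nnreal, ENNReal.ofReal_sub _ q.coe_nonneg,
      ENNReal.ofReal_one, ENNReal.ofReal_coe_nnreal]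
  rw [h2, expNeg_ofReal (mul_nonneg r.coe_nonneg (by linarith))]
  congr 2
  ring

/-- A simple function summed over a sequence of points. -/
lemma tsum_simpleFunc_eq_sum_pointCount {Ω : Type*} (X : ℕ → Ω → Plane) (f : SimpleFunc Plane ℝ≥0∞) (ω : Ω) :
    ∑' j, f (X j ω) =
      ∑ a ∈ f.range.filter (· ≠ 0), a * pointCount X (f ⁻¹' {a}) ω := by
  simp_rw [pointCount, ← ENNReal.tsum_mul_left]
  rw [← Summable.tsum_finsetSum fun _ _ => ENNReal.summable]
  refine tsum_congr fun j => ?_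
  by_cases h0 : f (X j ω) = 0
  · rw [h0, Finset.sum_eq_zero]
    intro a ha
    rw [Set.indicator_of_notMem, mul_zero]
    intro h
    exact (Finset.mem_filter.1 ha).2 (h.symm.trans h0)
  · rw [Finset.sum_eq_single (f (X j ω))]
    · rw [Set.indicator_of_mem (by simp), mul_one]
    · intro a _ ha
      rw [Set.indicator_of_notMem, mul_zero]
      exact fun h => ha (h : f (X j ω) = a).symm
    · intro h
      exact absurd (Finset.mem_filter.2 ⟨f.mem_range_self _, h0⟩) h

section Poisson

variable {Ω : Type*} [MeasurableSpace Ω] {Pr : Measure Ω} {X : ℕ → Ω → Plane} {lam : ℝ}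

lemma IsPoissonProcess.measurable_pointCount (hX : IsPoissonProcess Pr X lam) {B : Set Plane}
    (hB : MeasurableSet B) : Measurable (pointCount X B) :=
  Measurable.tsum fun j => (measurable_const.indicator hB).comp (hX.measurable j)

/-- The Laplace transform of the number of points in a set. -/
lemma IsPoissonProcess.lintegral_expNeg_pointCount (hX : IsPoissonProcess Pr X lam)
    {B : Set Plane} (hB : MeasurableSet B) (hvol : volume B ≠ ∞) (a : ℝ≥0∞) :
    ∫⁻ ω, expNeg (a * pointCount X B ω) ∂Pr =
      expNeg (ENNReal.ofReal lam * (volume B * (1 - expNeg a))) := by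
  have hm : Measurable fun x : ℝ≥0∞ => expNeg (a * x) := by fun_prop
  have hc : Measurable fun n : ℕ => (n : ℝ≥0∞) := measurable_of_countable _
  calc ∫⁻ ω, expNeg (a * pointCount X B ω) ∂Pr
      = ∫⁻ x, expNeg (a * x) ∂(Pr.map (pointCount X B)) :=
        (lintegral_map hm (hX.measurable_pointCount hB)).symm
    _ = _ := by
        rw [hX.law B hB hvol, lintegral_map hm hc, lintegral_expNeg_poissonMeasure,
          ENNReal.coe_mul, ENNReal.coe_toNNReal hvol, mul_assoc]
        rfl

lemma IsPoissonProcess.iIndepFun_pointCount (hX : IsPoissonProcess Pr X lam)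
    {ι : Type*} [Fintype ι] {B : ι → Set Plane} (hB : ∀ i, MeasurableSet (B i))
    (hvol : ∀ i, volume (B i) ≠ ∞) (hd : Pairwise fun i j => Disjoint (B i) (B j)) :
    iIndepFun (fun i => pointCount X (B i)) Pr := by
  let e := (Fintype.equivFin ι).symm
  refine iIndepFun.of_precomp e.surjective ?_
  exact hX.indep _ (fun i => B (e i)) (fun i => hB _) (fun i => hvol _)
    fun i j hij => hd (e.injective.ne hij)

/-- The Laplace functional of a Poisson process at a simple function. -/
lemma IsPoissonProcess.lintegral_expNeg_tsum_simpleFunc (hX : IsPoissonProcess Pr X lam)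
    (f : SimpleFunc Plane ℝ≥0∞) (hf : ∀ a, a ≠ 0 → volume (f ⁻¹' {a}) ≠ ∞) :
    ∫⁻ ω, expNeg (∑' j, f (X j ω)) ∂Pr =
      expNeg (ENNReal.ofReal lam * ∫⁻ x, (1 - expNeg (f x))) := by
  -- The value `0` is dropped: its fiber may have infinite area, where the Poisson law and
  -- independence are not available. It contributes nothing to either side, as `expNeg 0 = 1`.
  set s := f.range.filter (· ≠ 0) with hs
  have hind : iIndepFun (fun a : s => pointCount X (f ⁻¹' {(a : ℝ≥0∞)})) Pr := by
    refine hX.iIndepFun_pointCount (fun a => f.measurableSet_fiber _)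
      (fun a => hf _ (Finset.mem_filter.1 a.2).2) fun a b hab => ?_
    exact Disjoint.preimage _ (Set.disjoint_singleton.2 (Subtype.coe_injective.ne hab))
  have hm : ∀ a, Measurable (pointCount X (f ⁻¹' {a})) := fun a =>
    hX.measurable_pointCount (f.measurableSet_fiber _)
  have hprod : ∫⁻ ω, ∏ a : s, expNeg (a * pointCount X (f ⁻¹' {(a : ℝ≥0∞)}) ω) ∂Pr =
      ∏ a : s, ∫⁻ ω, expNeg (a * pointCount X (f ⁻¹' {(a : ℝ≥0∞)}) ω) ∂Pr := by
    refine lintegral_prod_eq_prod_lintegral_of_indepFun Finset.univ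
      (fun (a : s) ω => expNeg (a * pointCount X (f ⁻¹' {(a : ℝ≥0∞)}) ω))
      (hind.comp (fun (a : s) x => expNeg (a * x)) fun a => by fun_prop) fun a => ?_
    have := hm a
    fun_prop
  calc ∫⁻ ω, expNeg (∑' j, f (X j ω)) ∂Pr
      = ∫⁻ ω, ∏ a : s, expNeg (a * pointCount X (f ⁻¹' {(a : ℝ≥0∞)}) ω) ∂Pr := by
        refine lintegral_congr fun ω => ?_
        rw [tsum_simpleFunc_eq_sum_pointCount, expNeg_sum, ← hs, ← Finset.prod_coe_sort]
    _ = ∏ a : s, expNeg (ENNReal.ofReal lam * (volume (f ⁻¹' {(a : ℝ≥0∞)}) * (1 - expNeg a))) := by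
        rw [hprod]
        refine Finset.prod_congr rfl fun a _ => ?_
        exact hX.lintegral_expNeg_pointCount (f.measurableSet_fiber _)
          (hf _ (Finset.mem_filter.1 a.2).2) a
    _ = expNeg (ENNReal.ofReal lam * ∫⁻ x, (1 - expNeg (f x))) := by
        have h1 : ∫⁻ x, (1 - expNeg (f x)) = (f.map fun a => 1 - expNeg a).lintegral volume := by
          rw [← SimpleFunc.lintegral_eq_lintegral]
          rfl
        rw [← expNeg_sum, ← Finset.mul_sum, h1, SimpleFunc.map_lintegral,
          Finset.sum_coe_sort s fun a => volume (f ⁻¹' {a}) * (1 - expNeg a), hs,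
          Finset.sum_filter]
        congr 2
        refine Finset.sum_congr rfl fun a _ => ?_
        split_ifs with h
        · rw [mul_comm]
        · rw [not_not.1 h]
          simp

/-- The Laplace functional of a Poisson process. -/
theorem IsPoissonProcess.lintegral_expNeg_tsum [IsProbabilityMeasure Pr]
    (hX : IsPoissonProcess Pr X lam) {f : Plane → ℝ≥0∞} (hf : Measurable f) :
    ∫⁻ ω, expNeg (∑' j, f (X j ω)) ∂Pr =
      expNeg (ENNReal.ofReal lam * ∫⁻ x, (1 - expNeg (f x))) := by
  -- Cutting off to balls makes every fiber over a nonzero value bounded, hence of finite area, and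
  -- keeps the sequence increasing.
  let F : ℕ → SimpleFunc Plane ℝ≥0∞ := fun n =>
    (SimpleFunc.eapprox f n).restrict (Metric.ball 0 n)
  have hFapp : ∀ n x, F n x =
      (Metric.ball (0 : Plane) (n : ℝ)).indicator (SimpleFunc.eapprox f n) x := fun n x => by
    rw [SimpleFunc.restrict_apply _ measurableSet_ball]
  have hmono : ∀ x, Monotone fun n => F n x := by
    intro x m n hmn
    dsimp only
    rw [hFapp, hFapp]
    refine (Set.indicator_le_indicator (SimpleFunc.monotone_eapprox f hmn x)).trans ?_
    exact Set.indicator_le_indicator_of_subset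
      (Metric.ball_subset_ball (by exact_mod_cast hmn)) (fun _ => zero_le) x
  have hlim : ∀ x, Filter.Tendsto (fun n => F n x) Filter.atTop (nhds (f x)) := by
    intro x
    refine (SimpleFunc.tendsto_eapprox hf x).congr' ?_
    obtain ⟨N, hN⟩ := exists_nat_gt ‖x‖
    filter_upwards [Filter.eventually_ge_atTop N] with n hn
    rw [hFapp, Set.indicator_of_mem]
    rw [mem_ball_zero_iff]
    exact hN.trans_le (by exact_mod_cast hn)
  have hfin : ∀ n a, a ≠ 0 → volume (F n ⁻¹' {a}) ≠ ∞ := by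
    intro n a ha
    refine ((measure_mono ?_).trans_lt (measure_ball_lt_top (x := (0 : Plane)) (r := n))).ne
    intro x hx
    by_contra h
    exact ha ((hx : F n x = a).symm.trans (by rw [hFapp, Set.indicator_of_notMem h]))
  have hsum : ∀ ω, Filter.Tendsto (fun n => ∑' j, F n (X j ω)) Filter.atTop
      (nhds (∑' j, f (X j ω))) := by
    intro ω
    -- As integrals against counting measure, the sums are subject to monotone convergence.
    simp_rw [← lintegral_count]
    exact lintegral_tendsto_of_tendsto_of_monotone (fun n => by fun_prop)
      (Filter.Eventually.of_forall fun j => hmono _)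
      (Filter.Eventually.of_forall fun j => hlim _)
  have hleft := tendsto_lintegral_expNeg Pr
    (fun n => Measurable.tsum fun j => (F n).measurable.comp (hX.measurable j)) hsum
  have hint : Filter.Tendsto (fun n => ∫⁻ x, (1 - expNeg (F n x))) Filter.atTop
      (nhds (∫⁻ x, (1 - expNeg (f x)))) := by
    refine lintegral_tendsto_of_tendsto_of_monotone
      (fun n => (measurable_const.sub (measurable_expNeg.comp (F n).measurable)).aemeasurable)
      (Filter.Eventually.of_forall fun x m n hmn =>
        tsub_le_tsub_left (antitone_expNeg (hmono x hmn)) 1)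
      (Filter.Eventually.of_forall fun x => ?_)
    exact ENNReal.Tendsto.sub tendsto_const_nhds ((continuous_expNeg.tendsto _).comp (hlim x))
      (Or.inl ENNReal.one_ne_top)
  have hright : Filter.Tendsto
      (fun n => expNeg (ENNReal.ofReal lam * ∫⁻ x, (1 - expNeg (F n x)))) Filter.atTop
      (nhds (expNeg (ENNReal.ofReal lam * ∫⁻ x, (1 - expNeg (f x))))) :=
    (continuous_expNeg.tendsto _).comp
      (ENNReal.Tendsto.const_mul hint (Or.inr ENNReal.ofReal_ne_top))
  refine tendsto_nhds_unique hleft (hright.congr fun n => ?_)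
  exact (hX.lintegral_expNeg_tsum_simpleFunc (F n) (hfin n)).symm

end Poisson

/-! ### The exponential distribution with mean one -/

lemma lintegral_expMeasure_one (f : ℝ → ℝ≥0∞) (hf : Measurable f) :
    ∫⁻ x, f x ∂(expMeasure 1) = ∫⁻ x in Set.Ioi 0, ENNReal.ofReal (Real.exp (-x)) * f x := by
  have h0 : expMeasure 1 = volume.withDensity (exponentialPDF 1) := rfl
  have hm : Measurable (exponentialPDF 1) := (measurable_exponentialPDFReal 1).ennreal_ofReal
  rw [h0, lintegral_withDensity_eq_lintegral_mul _ hm hf, ← setLIntegral_univ,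
    ← lintegral_indicator measurableSet_Ioi, setLIntegral_univ]
  refine lintegral_congr_ae ?_
  -- The density is `1` at `0`, which the open half line leaves out; a single point is null.
  filter_upwards [Measure.ae_ne volume (0 : ℝ)] with x hx
  rw [Pi.mul_apply, exponentialPDF_eq]
  rcases lt_or_gt_of_ne hx with h | h
  · rw [if_neg h.not_ge, Set.indicator_of_notMem (by simpa using h.le)]
    simp
  · rw [if_pos h.le, Set.indicator_of_mem (by simpa using h)]
    simp

lemma integral_expMeasure_one (f : ℝ → ℝ) :
    ∫ x, f x ∂(expMeasure 1) = ∫ x in Set.Ioi 0, Real.exp (-x) * f x := by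
  have h0 : expMeasure 1 = volume.withDensity (exponentialPDF 1) := rfl
  have hm : Measurable (exponentialPDF 1) := (measurable_exponentialPDFReal 1).ennreal_ofReal
  rw [h0, integral_withDensity_eq_integral_toReal_smul hm
    (Filter.Eventually.of_forall fun x => ENNReal.ofReal_lt_top),
    ← integral_indicator measurableSet_Ioi]
  refine integral_congr_ae ?_
  filter_upwards [Measure.ae_ne volume (0 : ℝ)] with x hx
  rw [exponentialPDF_eq]
  rcases lt_or_gt_of_ne hx with h | h
  · rw [if_neg h.not_ge, Set.indicator_of_notMem (by simpa using h.le)]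
    simp
  · rw [if_pos h.le, Set.indicator_of_mem (by simpa using h)]
    simp [ENNReal.toReal_ofReal (Real.exp_pos _).le]

lemma ae_pos_expMeasure_one : ∀ᵐ x ∂(expMeasure 1), 0 < x := by
  rw [ae_iff]
  have hm : MeasurableSet {x : ℝ | ¬ 0 < x} := measurableSet_Ioi.compl
  have h := lintegral_expMeasure_one ({x : ℝ | ¬ 0 < x}.indicator 1) (measurable_one.indicator hm)
  rw [lintegral_indicator_one hm] at h
  rw [h, setLIntegral_congr_fun measurableSet_Ioi (g := fun _ => 0), lintegral_zero]
  intro x hx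
  simp [Set.mem_Ioi.1 hx]

lemma lintegral_exp_neg_mul_Ioi {c : ℝ} (hc : 0 < c) :
    ∫⁻ x in Set.Ioi 0, ENNReal.ofReal (Real.exp (-(c * x))) = ENNReal.ofReal (1 / c) := by
  have hi := exp_neg_integrableOn_Ioi 0 hc
  have := integral_exp_mul_Ioi (a := -c) (by linarith) 0
  simp only [neg_mul] at this hi
  rw [← ofReal_integral_eq_lintegral_ofReal hi
    (Filter.Eventually.of_forall fun x => (Real.exp_pos _).le), this]
  simp

/-- The Laplace transform of the exponential distribution with mean `1`. -/
lemma lintegral_expNeg_expMeasure_one {t : ℝ} (ht : 0 ≤ t) :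
    ∫⁻ x, expNeg (ENNReal.ofReal (t * x)) ∂(expMeasure 1) = ENNReal.ofReal (1 / (1 + t)) := by
  rw [lintegral_expMeasure_one _ (by fun_prop), ← lintegral_exp_neg_mul_Ioi (by linarith)]
  refine setLIntegral_congr_fun measurableSet_Ioi fun x hx => ?_
  rw [expNeg_ofReal (mul_nonneg ht (le_of_lt hx)), ← ENNReal.ofReal_mul (Real.exp_pos _).le,
    ← Real.exp_add]
  congr 2
  ring

/-! ### Gamma and Beta integrals, and the path loss integral over the plane -/

lemma lintegral_rpow_mul_exp_neg_mul_Ioi {a r : ℝ} (ha : 0 < a) (hr : 0 < r) :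
    ∫⁻ x in Set.Ioi 0, ENNReal.ofReal (x ^ (a - 1) * Real.exp (-(r * x))) =
      ENNReal.ofReal ((1 / r) ^ a * Real.Gamma a) := by
  have h := Real.integral_rpow_mul_exp_neg_mul_Ioi ha hr
  rw [← h, ofReal_integral_eq_lintegral_ofReal]
  -- Integrability comes from the value: a non-integrable function would have integral `0`, but the
  -- Gamma expression is positive.
  · by_contra hcon
    rw [integral_undef hcon] at h
    have : 0 < (1 / r) ^ a * Real.Gamma a :=
      mul_pos (Real.rpow_pos_of_pos (by positivity) _) (Real.Gamma_pos_of_pos ha)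
    linarith
  · filter_upwards [ae_restrict_mem measurableSet_Ioi] with x hx
    exact mul_nonneg (Real.rpow_nonneg (le_of_lt hx) _) (Real.exp_pos _).le

/-- The Beta integral `∫ x ^ (a - 1) / (1 + x / t)` over the positive half line. -/
lemma lintegral_rpow_div_one_add_div {a t : ℝ} (ha : 0 < a) (ha1 : a < 1) (ht : 0 < t) :
    ∫⁻ x in Set.Ioi 0, ENNReal.ofReal (x ^ (a - 1) / (1 + x / t)) =
      ENNReal.ofReal (t ^ a * (Real.pi / Real.sin (Real.pi * a))) := by
  -- Write `1 / (1 + x / t) = t ∫ exp (-(t + x) u) du` and apply Tonelli: the integral over `x`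
  -- produces `Γ(a)`, the one over `u` produces `Γ(1 - a)`, and the reflection formula gives the
  -- sine.
  have h1 : ∀ x ∈ Set.Ioi (0 : ℝ), ENNReal.ofReal (x ^ (a - 1) / (1 + x / t)) =
      ∫⁻ u in Set.Ioi 0, ENNReal.ofReal (t * x ^ (a - 1) * Real.exp (-((t + x) * u))) := by
    intro x hx
    have hx : 0 < x := hx
    have hp : 0 ≤ t * x ^ (a - 1) := by positivity
    simp_rw [ENNReal.ofReal_mul hp]
    rw [lintegral_const_mul _ (by fun_prop), lintegral_exp_neg_mul_Ioi (by positivity),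
      ← ENNReal.ofReal_mul hp]
    congr 1
    field_simp
  rw [setLIntegral_congr_fun measurableSet_Ioi h1, lintegral_lintegral_swap (by fun_prop)]
  have h2 : ∀ u ∈ Set.Ioi (0 : ℝ),
      ∫⁻ x in Set.Ioi 0, ENNReal.ofReal (t * x ^ (a - 1) * Real.exp (-((t + x) * u))) =
      ENNReal.ofReal (t * Real.Gamma a) *
        ENNReal.ofReal (u ^ ((1 - a) - 1) * Real.exp (-(t * u))) := by
    intro u hu
    have hu : 0 < u := hu
    have h3 : ∀ x : ℝ, t * x ^ (a - 1) * Real.exp (-((t + x) * u)) =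
        t * Real.exp (-(t * u)) * (x ^ (a - 1) * Real.exp (-(u * x))) := by
      intro x
      rw [show -((t + x) * u) = -(t * u) + -(u * x) by ring, Real.exp_add]
      ring
    have hp : 0 ≤ t * Real.exp (-(t * u)) := by positivity
    simp_rw [h3, ENNReal.ofReal_mul hp]
    rw [lintegral_const_mul _ (by fun_prop), lintegral_rpow_mul_exp_neg_mul_Ioi ha hu,
      ← ENNReal.ofReal_mul hp,
      ← ENNReal.ofReal_mul (mul_nonneg ht.le (Real.Gamma_pos_of_pos ha).le)]
    congr 1
    rw [show (1 - a) - 1 = -a by ring, Real.rpow_neg hu.le, one_div, Real.inv_rpow hu.le]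
    ring
  rw [setLIntegral_congr_fun measurableSet_Ioi h2, lintegral_const_mul _ (by fun_prop),
    lintegral_rpow_mul_exp_neg_mul_Ioi (by linarith) ht,
    ← ENNReal.ofReal_mul (mul_nonneg ht.le (Real.Gamma_pos_of_pos ha).le),
    ← Real.Gamma_mul_Gamma_one_sub]
  congr 1
  rw [one_div, Real.inv_rpow ht.le, Real.rpow_sub ht, Real.rpow_one]
  field_simp

/-- The integral over the plane of the Laplace exponent of a point with path loss exponent `α`. -/
lemma lintegral_plane_pathLoss {α t : ℝ} (hα : 2 < α) (ht : 0 < t) :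
    ∫⁻ x : Plane, ENNReal.ofReal (1 - 1 / (1 + t * ‖x‖ ^ (-α))) =
      ENNReal.ofReal (2 * Real.pi ^ 2 * t ^ (2 / α) / (α * Real.sin (2 * Real.pi / α))) := by
  have hα0 : 0 < α := by linarith
  have ha : 0 < 2 / α := by positivity
  have ha1 : 2 / α < 1 := (div_lt_one hα0).2 hα
  set b : ℝ := t ^ (2 / α) * (Real.pi / Real.sin (Real.pi * (2 / α))) with hb
  have hbnn : 0 ≤ b := by
    have : 0 < Real.sin (Real.pi * (2 / α)) :=
      Real.sin_pos_of_pos_of_lt_pi (by positivity) (by nlinarith [Real.pi_pos])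
    positivity
  -- The radial integrand after the substitution `x = y ^ α`.
  let g : ℝ → ℝ := fun x => 1 / α * (x ^ (2 / α - 1) / (1 + x / t))
  have hnn : 0 ≤ᵐ[volume.restrict (Set.Ioi 0)] fun x : ℝ => x ^ (2 / α - 1) / (1 + x / t) := by
    filter_upwards [ae_restrict_mem measurableSet_Ioi] with x hx
    have hx : 0 < x := hx
    simp only [Pi.zero_apply]
    positivity
  have hm : Measurable fun x : ℝ => x ^ (2 / α - 1) / (1 + x / t) := by fun_prop
  have hlint := lintegral_rpow_div_one_add_div ha ha1 ht
  have hi : IntegrableOn (fun x : ℝ => x ^ (2 / α - 1) / (1 + x / t)) (Set.Ioi 0) := by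
    refine ⟨hm.aestronglyMeasurable, ?_⟩
    rw [hasFiniteIntegral_iff_ofReal hnn, hlint]
    exact ENNReal.ofReal_lt_top
  have hg : IntegrableOn g (Set.Ioi 0) := hi.const_mul _
  have hgint : ∫ x in Set.Ioi 0, g x = 1 / α * b := by
    rw [integral_const_mul, integral_eq_lintegral_of_nonneg_ae hnn hm.aestronglyMeasurable, hlint,
      ENNReal.toReal_ofReal hbnn]
  let F : ℝ → ℝ := fun y => 1 - 1 / (1 + t * y ^ (-α))
  have hFg : ∀ y ∈ Set.Ioi (0 : ℝ), (α * y ^ (α - 1)) • g (y ^ α) = y ^ (2 - 1) • F y := by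
    intro y hy
    have hy : 0 < y := hy
    have hya : 0 < y ^ α := Real.rpow_pos_of_pos hy _
    simp only [g, F, smul_eq_mul]
    rw [← Real.rpow_mul hy.le, show α * (2 / α - 1) = 2 - α by field_simp,
      Real.rpow_sub hy, Real.rpow_sub hy, Real.rpow_neg hy.le, Real.rpow_one]
    norm_num
    field_simp
    ring
  have hdim : Module.finrank ℝ Plane = 2 := by simp
  have hFi : Integrable (fun x : Plane => F ‖x‖) := by
    rw [integrable_fun_norm_addHaar volume, hdim]
    refine IntegrableOn.congr_fun ?_ hFg measurableSet_Ioi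
    have := (integrableOn_Ioi_comp_rpow_iff g hα0.ne').2 hg
    rwa [abs_of_pos hα0] at this
  have hFnn : ∀ x : Plane, 0 ≤ F ‖x‖ := by
    intro x
    have : 0 ≤ t * ‖x‖ ^ (-α) := mul_nonneg ht.le (Real.rpow_nonneg (norm_nonneg _) _)
    simp only [F, sub_nonneg]
    rw [div_le_one (by linarith)]
    linarith
  -- Polar coordinates contribute the dimension times the area of the unit disc, that is `2 * π`.
  have hball : (volume : Measure Plane).real (Metric.ball 0 1) = Real.pi := by
    rw [Measure.real, EuclideanSpace.volume_ball_fin_two]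
    simp [Real.pi_pos.le]
  rw [← ofReal_integral_eq_lintegral_ofReal hFi (Filter.Eventually.of_forall hFnn),
    integral_fun_norm_addHaar volume F, hdim, hball,
    ← setIntegral_congr_fun measurableSet_Ioi hFg, integral_comp_rpow_Ioi_of_pos hα0, hgint]
  congr 1
  rw [hb, show 2 * Real.pi / α = Real.pi * (2 / α) by ring]
  simp only [smul_eq_mul, nsmul_eq_mul]
  push_cast
  ring

/-! ### Independence and the Laplace transform of the interference -/

/-- Fubini for a function of two independent random variables. -/
lemma lintegral_comp_prodMk_of_indepFun {Ω α β : Type*} [MeasurableSpace Ω] [MeasurableSpace α]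
    [MeasurableSpace β] {Pr : Measure Ω} [IsProbabilityMeasure Pr] {A : Ω → α} {B : Ω → β}
    (hA : Measurable A) (hB : Measurable B) (hAB : IndepFun A B Pr) {F : α × β → ℝ≥0∞}
    (hF : Measurable F) :
    ∫⁻ ω, F (A ω, B ω) ∂Pr = ∫⁻ ω, ∫⁻ ω', F (A ω, B ω') ∂Pr ∂Pr := by
  have : IsProbabilityMeasure (Pr.map B) := Measure.isProbabilityMeasure_map hB.aemeasurable
  rw [← lintegral_map (f := F) hF (hA.prodMk hB),
    hAB.map_prod_eq_prod_map_map hA.aemeasurable hB.aemeasurable,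
    lintegral_prod _ hF.aemeasurable, lintegral_map hF.lintegral_prod_right' hA]
  refine lintegral_congr fun ω => ?_
  rw [lintegral_map (by fun_prop) hB]

namespace IsSFNNetwork

variable {Ω : Type*} [MeasurableSpace Ω] {Pr : Measure Ω} [IsProbabilityMeasure Pr] {M : ℕ}
  {N : SFNParams M} {X : ℕ → Ω → Plane} {los : ℕ → Ω → Bool} {h : ℕ → Ω → ℝ}
  {g : Fin M → Ω → ℝ}

/-- Fubini for a function of the points, the marks and the fading coefficients. -/
lemma lintegral_comp (hN : IsSFNNetwork N Pr X los h g)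
    {F : (ℕ → Plane) × (ℕ → Bool) × (ℕ → ℝ) × (Fin M → ℝ) → ℝ≥0∞} (hF : Measurable F) :
    ∫⁻ ω, F (fun j => X j ω, fun j => los j ω, fun j => h j ω, fun i => g i ω) ∂Pr =
      ∫⁻ ω₁, ∫⁻ ω₂, ∫⁻ ω₃, ∫⁻ ω₄,
        F (fun j => X j ω₁, fun j => los j ω₂, fun j => h j ω₃, fun i => g i ω₄)
        ∂Pr ∂Pr ∂Pr ∂Pr := by
  have hX := measurable_pi_lambda (fun ω j => X j ω) hN.poisson.measurable
  have hl := measurable_pi_lambda (fun ω j => los j ω) hN.los_measurable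
  have hh := measurable_pi_lambda (fun ω j => h j ω) hN.h_measurable
  have hg := measurable_pi_lambda (fun ω i => g i ω) hN.g_measurable
  rw [lintegral_comp_prodMk_of_indepFun hX (hl.prodMk (hh.prodMk hg)) hN.indep_points hF]
  refine lintegral_congr fun ω₁ => ?_
  rw [lintegral_comp_prodMk_of_indepFun (F := fun y => F (fun j => X j ω₁, y)) hl (hh.prodMk hg)
    hN.indep_los (by fun_prop)]
  refine lintegral_congr fun ω₂ => ?_
  rw [lintegral_comp_prodMk_of_indepFun
    (F := fun y => F (fun j => X j ω₁, fun j => los j ω₂, y)) hh hg hN.indep_fading (by fun_prop)]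

end IsSFNNetwork

namespace SFNParams

variable {M : ℕ} (N : SFNParams M)

lemma pathLoss_nonneg (b : Bool) {r : ℝ} (hr : 0 ≤ r) : 0 ≤ N.pathLoss b r := by
  rw [pathLoss]
  split_ifs <;> exact Real.rpow_nonneg hr _

@[fun_prop]
lemma measurable_pathLoss : Measurable fun p : Bool × ℝ => N.pathLoss p.1 p.2 := by
  refine measurable_from_prod_countable_right fun b => ?_
  cases b <;> simp only [pathLoss] <;> simp <;> fun_prop

/-- The interference as a function of the points, the marks and the fading coefficients. -/
noncomputable def interferenceAt (x : ℕ → Plane) (b : ℕ → Bool) (y : ℕ → ℝ) : ℝ≥0∞ :=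
  ENNReal.ofReal (N.GI * N.GR * N.PI) *
    ∑' j, ENNReal.ofReal (y j * N.pathLoss (b j) ‖x j‖)

lemma measurable_interferenceAt :
    Measurable fun p : (ℕ → Plane) × (ℕ → Bool) × (ℕ → ℝ) =>
      N.interferenceAt p.1 p.2.1 p.2.2 := by
  refine Measurable.const_mul (Measurable.tsum fun j => ?_) _
  have : Measurable fun p : (ℕ → Plane) × (ℕ → Bool) × (ℕ → ℝ) =>
      N.pathLoss (p.2.1 j) ‖p.1 j‖ :=
    N.measurable_pathLoss.comp (f := fun p : (ℕ → Plane) × (ℕ → Bool) × (ℕ → ℝ) =>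
      (p.2.1 j, ‖p.1 j‖)) (by fun_prop)
  fun_prop

/-- The Laplace transform at `t` of the power received from a point at distance `r`. -/
noncomputable def pointLaplace (t r : ℝ) : ℝ :=
  N.pL * (1 / (1 + t * N.pathLoss true r)) + (1 - N.pL) * (1 / (1 + t * N.pathLoss false r))

lemma one_div_one_add_mem {t : ℝ} (ht : 0 ≤ t) : 0 < 1 / (1 + t) ∧ 1 / (1 + t) ≤ 1 :=
  ⟨by positivity, by rw [div_le_one (by linarith)]; linarith⟩

/-- A convex combination of two numbers in `(0, 1]`. Both bounds are needed for `-log` of it to be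
an admissible (finite, nonnegative) function in the Laplace functional. -/
lemma pointLaplace_mem {t r : ℝ} (ht : 0 ≤ t) (hr : 0 ≤ r) :
    0 < N.pointLaplace t r ∧ N.pointLaplace t r ≤ 1 := by
  obtain ⟨h1, h2⟩ := one_div_one_add_mem (mul_nonneg ht (N.pathLoss_nonneg true hr))
  obtain ⟨h3, h4⟩ := one_div_one_add_mem (mul_nonneg ht (N.pathLoss_nonneg false hr))
  have hp := N.pL_nonneg
  have hp1 := N.pL_le_one
  rw [pointLaplace]
  constructor
  · rcases hp.eq_or_lt with h | h
    · rw [← h]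
      linarith
    · have := mul_pos h h1
      have := mul_nonneg (sub_nonneg.2 hp1) h3.le
      linarith
  · nlinarith

lemma measurable_pointLaplace (t : ℝ) : Measurable fun x : Plane => N.pointLaplace t ‖x‖ := by
  have h (b : Bool) : Measurable fun x : Plane => N.pathLoss b ‖x‖ :=
    N.measurable_pathLoss.comp (f := fun x : Plane => (b, ‖x‖)) (by fun_prop)
  have := h true
  have := h false
  unfold pointLaplace
  fun_prop

end SFNParams

namespace IsSFNNetwork

variable {Ω : Type*} [MeasurableSpace Ω] {Pr : Measure Ω} {M : ℕ}
  {N : SFNParams M} {X : ℕ → Ω → Plane} {los : ℕ → Ω → Bool} {h : ℕ → Ω → ℝ}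
  {g : Fin M → Ω → ℝ}

lemma measurable_interference (hN : IsSFNNetwork N Pr X los h g) :
    Measurable (N.interference X los h) :=
  N.measurable_interferenceAt.comp
    ((measurable_pi_lambda (fun ω j => X j ω) hN.poisson.measurable).prodMk
      ((measurable_pi_lambda (fun ω j => los j ω) hN.los_measurable).prodMk
        (measurable_pi_lambda (fun ω j => h j ω) hN.h_measurable)))

variable [IsProbabilityMeasure Pr]

/-- The distribution of a line-of-sight mark. -/
lemma lintegral_comp_los (hN : IsSFNNetwork N Pr X los h g) (j : ℕ) (f : Bool → ℝ≥0∞) :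
    ∫⁻ ω, f (los j ω) ∂Pr =
      ENNReal.ofReal N.pL * f true + ENNReal.ofReal (1 - N.pL) * f false := by
  have hm := hN.los_measurable j
  have ht : Pr.map (los j) {true} = ENNReal.ofReal N.pL := by
    rw [Measure.map_apply hm (measurableSet_singleton _), ← hN.los_law j]
    rfl
  have : IsProbabilityMeasure (Pr.map (los j)) := Measure.isProbabilityMeasure_map hm.aemeasurable
  have hf : Pr.map (los j) {false} = ENNReal.ofReal (1 - N.pL) := by
    rw [show ({false} : Set Bool) = {true}ᶜ by ext b; cases b <;> simp,
      prob_compl_eq_one_sub (measurableSet_singleton _), ht, ENNReal.ofReal_sub _ N.pL_nonneg,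
      ENNReal.ofReal_one]
  rw [← lintegral_map (f := f) (measurable_of_countable _) hm, lintegral_fintype,
    Fintype.sum_bool, ht, hf, mul_comm, mul_comm (f false)]

/-- The Laplace transform of the power received from finitely many points at given places. -/
lemma lintegral_lintegral_expNeg_sum (hN : IsSFNNetwork N Pr X los h g) {t : ℝ} (ht : 0 ≤ t)
    (x : ℕ → Plane) (n : ℕ) :
    ∫⁻ ω₂, ∫⁻ ω₃, expNeg (∑ j ∈ Finset.range n,
        ENNReal.ofReal (t * (h j ω₃ * N.pathLoss (los j ω₂) ‖x j‖))) ∂Pr ∂Pr =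
      ∏ j ∈ Finset.range n, ENNReal.ofReal (N.pointLaplace t ‖x j‖) := by
  have hpl (b : Bool) (j : ℕ) : 0 ≤ t * N.pathLoss b ‖x j‖ :=
    mul_nonneg ht (N.pathLoss_nonneg b (norm_nonneg _))
  have hinner (ω₂ : Ω) : ∫⁻ ω₃, expNeg (∑ j ∈ Finset.range n,
        ENNReal.ofReal (t * (h j ω₃ * N.pathLoss (los j ω₂) ‖x j‖))) ∂Pr =
      ∏ j ∈ Finset.range n,
        ENNReal.ofReal (1 / (1 + t * N.pathLoss (los j ω₂) ‖x j‖)) := by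
    -- With places and marks fixed, only the independent fading coefficients are random; the marks
    -- are averaged afterwards in the same way.
    let f : ℕ → ℝ → ℝ≥0∞ := fun j y =>
      expNeg (ENNReal.ofReal (t * N.pathLoss (los j ω₂) ‖x j‖ * y))
    have hf (j : ℕ) : Measurable (f j) := by fun_prop
    simp_rw [expNeg_sum]
    calc _ = ∫⁻ ω₃, ∏ j ∈ Finset.range n, f j (h j ω₃) ∂Pr := by
          refine lintegral_congr fun ω₃ => Finset.prod_congr rfl fun j _ => ?_
          simp only [f]
          congr 2
          ring
      _ = ∏ j ∈ Finset.range n, ∫⁻ ω₃, f j (h j ω₃) ∂Pr :=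
          lintegral_prod_eq_prod_lintegral_of_indepFun _ (fun j ω => f j (h j ω))
            (hN.h_indep.comp f hf) fun j => (hf j).comp (hN.h_measurable j)
      _ = _ := by
          refine Finset.prod_congr rfl fun j _ => ?_
          rw [← lintegral_map (hf j) (hN.h_measurable j), hN.h_law,
            lintegral_expNeg_expMeasure_one (hpl _ _)]
  simp_rw [hinner]
  let f : ℕ → Bool → ℝ≥0∞ := fun j b => ENNReal.ofReal (1 / (1 + t * N.pathLoss b ‖x j‖))
  have hf (j : ℕ) : Measurable (f j) := measurable_of_countable _
  rw [lintegral_prod_eq_prod_lintegral_of_indepFun _ (fun j ω => f j (los j ω))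
    (hN.los_indep.comp f hf) fun j => (hf j).comp (hN.los_measurable j)]
  refine Finset.prod_congr rfl fun j _ => ?_
  have h1 := (SFNParams.one_div_one_add_mem (hpl true j)).1.le
  have h2 := (SFNParams.one_div_one_add_mem (hpl false j)).1.le
  rw [hN.lintegral_comp_los, SFNParams.pointLaplace, ENNReal.ofReal_add
    (mul_nonneg N.pL_nonneg h1) (mul_nonneg (sub_nonneg.2 N.pL_le_one) h2),
    ENNReal.ofReal_mul N.pL_nonneg, ENNReal.ofReal_mul (sub_nonneg.2 N.pL_le_one)]

/-- The Laplace transform of the interference as an integral over the plane. -/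
lemma lintegral_expNeg_interference (hN : IsSFNNetwork N Pr X los h g) {s : ℝ} (hs : 0 < s) :
    ∫⁻ ω, expNeg (ENNReal.ofReal s * N.interference X los h ω) ∂Pr =
      expNeg (ENNReal.ofReal N.lam * ∫⁻ x : Plane,
        (1 - ENNReal.ofReal (N.pointLaplace (s * (N.GI * N.GR * N.PI)) ‖x‖))) := by
  set t := s * (N.GI * N.GR * N.PI) with ht_def
  have hc : 0 < N.GI * N.GR * N.PI := mul_pos (mul_pos N.GI_pos N.GR_pos) N.PI_pos
  have ht : 0 < t := mul_pos hs hc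
  let f : Plane → ℝ≥0∞ := fun x => ENNReal.ofReal (-Real.log (N.pointLaplace t ‖x‖))
  have hf : Measurable f := ((N.measurable_pointLaplace t).log.neg).ennreal_ofReal
  have hfe (x : Plane) : expNeg (f x) = ENNReal.ofReal (N.pointLaplace t ‖x‖) :=
    expNeg_ofReal_neg_log (N.pointLaplace_mem ht.le (norm_nonneg x)).1
      (N.pointLaplace_mem ht.le (norm_nonneg x)).2
  simp_rw [← hfe]
  rw [← hN.poisson.lintegral_expNeg_tsum hf]
  let Y : ℕ → Ω → ℝ≥0∞ := fun j ω =>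
    ENNReal.ofReal (t * (h j ω * N.pathLoss (los j ω) ‖X j ω‖))
  have hY (j : ℕ) : Measurable (Y j) := by
    have : Measurable fun ω => N.pathLoss (los j ω) ‖X j ω‖ :=
      N.measurable_pathLoss.comp ((hN.los_measurable j).prodMk (hN.poisson.measurable j).norm)
    have := hN.h_measurable j
    fun_prop
  have hI (ω : Ω) : ENNReal.ofReal s * N.interference X los h ω = ∑' j, Y j ω := by
    rw [SFNParams.interference, ← mul_assoc, ← ENNReal.ofReal_mul hs.le, ← ht_def,
      ← ENNReal.tsum_mul_left]
    exact tsum_congr fun j => (ENNReal.ofReal_mul ht.le).symm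
  simp_rw [hI]
  -- Independence factorises finite products only, so both sides are compared for the first `n`
  -- points and `n` tends to infinity.
  have hleft := tendsto_lintegral_expNeg Pr (F := fun n ω => ∑ j ∈ Finset.range n, Y j ω)
    (fun n => Finset.measurable_fun_sum _ fun j _ => hY j)
    fun ω => ENNReal.tendsto_nat_tsum fun j => Y j ω
  have hright := tendsto_lintegral_expNeg Pr (F := fun n ω => ∑ j ∈ Finset.range n, f (X j ω))
    (fun n => Finset.measurable_fun_sum _ fun j _ => hf.comp (hN.poisson.measurable j))
    fun ω => ENNReal.tendsto_nat_tsum fun j => f (X j ω)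
  refine tendsto_nhds_unique hleft (hright.congr fun n => ?_)
  let F : (ℕ → Plane) × (ℕ → Bool) × (ℕ → ℝ) × (Fin M → ℝ) → ℝ≥0∞ := fun p =>
    expNeg (∑ j ∈ Finset.range n,
      ENNReal.ofReal (t * (p.2.2.1 j * N.pathLoss (p.2.1 j) ‖p.1 j‖)))
  have hF : Measurable F := by
    refine measurable_expNeg.comp (Finset.measurable_fun_sum _ fun j _ => ?_)
    have : Measurable fun p : (ℕ → Plane) × (ℕ → Bool) × (ℕ → ℝ) × (Fin M → ℝ) =>
        N.pathLoss (p.2.1 j) ‖p.1 j‖ :=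
      N.measurable_pathLoss.comp
        (f := fun p : (ℕ → Plane) × (ℕ → Bool) × (ℕ → ℝ) × (Fin M → ℝ) =>
          (p.2.1 j, ‖p.1 j‖)) (by fun_prop)
    fun_prop
  -- The SFN fading does not enter `F`, so the innermost integral is that of a constant.
  calc ∫⁻ ω, expNeg (∑ j ∈ Finset.range n, f (X j ω)) ∂Pr
      = ∫⁻ ω₁, ∫⁻ ω₂, ∫⁻ ω₃, ∫⁻ _ω₄, expNeg (∑ j ∈ Finset.range n,
        ENNReal.ofReal (t * (h j ω₃ * N.pathLoss (los j ω₂) ‖X j ω₁‖))) ∂Pr ∂Pr ∂Pr ∂Pr := by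
        refine lintegral_congr fun ω => ?_
        simp_rw [lintegral_const, measure_univ, mul_one]
        rw [hN.lintegral_lintegral_expNeg_sum ht.le fun j => X j ω, expNeg_sum]
        simp_rw [hfe]
    _ = _ := (hN.lintegral_comp hF).symm

/-- The Laplace transform of the interference in closed form. -/
theorem laplaceTransform_interference (hN : IsSFNNetwork N Pr X los h g) (hL : 2 < N.αL)
    (hNL : 2 < N.αN) {s : ℝ} (hs : 0 < s) :
    laplaceTransform Pr (N.interference X los h) s =
      N.laplaceFactor (N.pL * N.lam) N.αL s * N.laplaceFactor ((1 - N.pL) * N.lam) N.αN s := by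
  rw [laplaceTransform_eq_toReal Pr hN.measurable_interference hs,
    hN.lintegral_expNeg_interference hs]
  set c := N.GI * N.GR * N.PI with hc_def
  have hc : 0 < c := mul_pos (mul_pos N.GI_pos N.GR_pos) N.PI_pos
  have ht : 0 < s * c := mul_pos hs hc
  have hp := N.pL_nonneg
  have hp1 := sub_nonneg.2 N.pL_le_one
  have hmem (α : ℝ) (x : Plane) := SFNParams.one_div_one_add_mem
    (mul_nonneg ht.le (Real.rpow_nonneg (norm_nonneg x) (-α)))
  let K : ℝ → ℝ := fun α =>
    2 * Real.pi ^ 2 * (s * c) ^ (2 / α) / (α * Real.sin (2 * Real.pi / α))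
  have hK (α : ℝ) (hα : 2 < α) : 0 ≤ K α := by
    have : 0 < Real.sin (2 * Real.pi / α) := by
      refine Real.sin_pos_of_pos_of_lt_pi (div_pos (by positivity) (by linarith)) ?_
      rw [div_lt_iff₀ (by linarith)]
      nlinarith [Real.pi_pos]
    have : 0 < α := by linarith
    positivity
  -- As the two mark probabilities add up to `1`, the exponent splits into a line-of-sight and a
  -- non-line-of-sight part, whence the two factors.
  have hsub (x : Plane) : 1 - ENNReal.ofReal (N.pointLaplace (s * c) ‖x‖) =
      ENNReal.ofReal N.pL * ENNReal.ofReal (1 - 1 / (1 + s * c * ‖x‖ ^ (-N.αL))) +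
      ENNReal.ofReal (1 - N.pL) * ENNReal.ofReal (1 - 1 / (1 + s * c * ‖x‖ ^ (-N.αN))) := by
    rw [← ENNReal.ofReal_mul hp, ← ENNReal.ofReal_mul hp1, ← ENNReal.ofReal_add
      (mul_nonneg hp (sub_nonneg.2 (hmem _ x).2)) (mul_nonneg hp1 (sub_nonneg.2 (hmem _ x).2)),
      ← ENNReal.ofReal_one,
      ← ENNReal.ofReal_sub _ (N.pointLaplace_mem ht.le (norm_nonneg x)).1.le]
    congr 1
    simp only [SFNParams.pointLaplace, SFNParams.pathLoss, if_true, Bool.false_eq_true, if_false]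
    ring
  simp_rw [hsub]
  rw [lintegral_add_left (by fun_prop), lintegral_const_mul _ (by fun_prop),
    lintegral_const_mul _ (by fun_prop), lintegral_plane_pathLoss hL ht,
    lintegral_plane_pathLoss hNL ht]
  change (expNeg (ENNReal.ofReal N.lam * (ENNReal.ofReal N.pL * ENNReal.ofReal (K N.αL) +
    ENNReal.ofReal (1 - N.pL) * ENNReal.ofReal (K N.αN)))).toReal = _
  have h1 := mul_nonneg hp (hK _ hL)
  have h2 := mul_nonneg hp1 (hK _ hNL)
  rw [← ENNReal.ofReal_mul hp, ← ENNReal.ofReal_mul hp1, ← ENNReal.ofReal_add h1 h2,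
    ← ENNReal.ofReal_mul N.lam_pos.le, expNeg_ofReal (mul_nonneg N.lam_pos.le (add_nonneg h1 h2)),
    ENNReal.toReal_ofReal (Real.exp_pos _).le, SFNParams.laplaceFactor, SFNParams.laplaceFactor,
    ← Real.exp_add, ← hc_def]
  congr 1
  simp only [K, Real.mul_rpow hs.le hc.le]
  ring

end IsSFNNetwork

/-! ### The tail of a sum of independent exponentials -/

/-- The coefficients of the hypoexponential distribution sum up to `1`. -/
lemma sum_prod_div_sub_eq_one {ι : Type*} [DecidableEq ι] {μ : ι → ℝ} {s : Finset ι}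
    (hs : s.Nonempty) (hpos : ∀ i ∈ s, 0 < μ i) (hinj : Set.InjOn μ s) :
    ∑ k ∈ s, ∏ j ∈ s.erase k, μ k / (μ k - μ j) = 1 := by
  -- The Lagrange basis polynomials at the nodes `1 / μ_k` sum to `1`; at `0` their factors are `(-1
  -- / μ_j) / (1 / μ_k - 1 / μ_j) = μ_k / (μ_k - μ_j)`.
  have hv : Set.InjOn (fun i => (μ i)⁻¹) s := fun i hi j hj hij => hinj hi hj (inv_injective hij)
  have h := congrArg (Polynomial.eval 0) (Lagrange.sum_basis hv hs)
  rw [Polynomial.eval_finsetSum, Polynomial.eval_one] at h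
  rw [← h]
  refine Finset.sum_congr rfl fun k hk => ?_
  rw [Lagrange.basis, Polynomial.eval_prod]
  refine Finset.prod_congr rfl fun j hj => ?_
  obtain ⟨hjk, hj⟩ := Finset.mem_erase.1 hj
  have h1 := hpos k hk
  have h2 := hpos j hj
  have h3 : μ k - μ j ≠ 0 := sub_ne_zero.2 fun h => hjk (hinj hj hk h.symm)
  have h4 : (μ k)⁻¹ - (μ j)⁻¹ ≠ 0 :=
    sub_ne_zero.2 fun h => hjk (hinj hj hk (inv_injective h).symm)
  have h5 : (μ k)⁻¹ - (μ j)⁻¹ = -((μ k - μ j) / (μ k * μ j)) := by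
    field_simp
    ring
  simp only [Lagrange.basisDivisor, Polynomial.eval_mul, Polynomial.eval_C, Polynomial.eval_sub,
    Polynomial.eval_X, zero_sub]
  rw [h5]
  field_simp

lemma intervalIntegral_exp_mul {a : ℝ} (ha : a ≠ 0) (c : ℝ) :
    ∫ t in (0 : ℝ)..c, Real.exp (a * t) = (Real.exp (a * c) - 1) / a := by
  rw [intervalIntegral.integral_comp_mul_left (fun x => Real.exp x) ha, integral_exp]
  simp
  ring

/-- The tail of the convolution of a mixture of exponential tails with an exponential
distribution. -/
lemma integral_Ioc_exp_neg_mul_sum {ι : Type*} {s : Finset ι} {μ A : ι → ℝ} {m x : ℝ} (hm : 0 < m)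
    (hx : 0 < x) (hpos : ∀ i ∈ s, 0 < μ i) (hne : ∀ i ∈ s, μ i ≠ m) :
    ∫ t in Set.Ioc 0 (x / m), Real.exp (-t) * ∑ k ∈ s, A k * Real.exp (-((x - m * t) / μ k)) =
      ∑ k ∈ s, A k * (μ k / (μ k - m)) * (Real.exp (-(x / μ k)) - Real.exp (-(x / m))) := by
  rw [← intervalIntegral.integral_of_le (by positivity)]
  simp_rw [Finset.mul_sum]
  rw [intervalIntegral.integral_finsetSum fun k _ =>
    Continuous.intervalIntegrable (by fun_prop) _ _]
  refine Finset.sum_congr rfl fun k hk => ?_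
  have h1 := hpos k hk
  have h2 : μ k - m ≠ 0 := sub_ne_zero.2 (hne k hk)
  -- Distinct means make the rate of the integrand nonzero; with equal means a term linear in `x`
  -- would appear.
  have h3 : m / μ k - 1 ≠ 0 := by
    rw [sub_ne_zero, Ne, div_eq_one_iff_eq h1.ne']
    exact (hne k hk).symm
  have h4 (t : ℝ) : Real.exp (-t) * (A k * Real.exp (-((x - m * t) / μ k))) =
      A k * Real.exp (-(x / μ k)) * Real.exp ((m / μ k - 1) * t) := by
    rw [mul_assoc, ← Real.exp_add, mul_left_comm, ← Real.exp_add]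
    congr 2
    field_simp
    ring
  have h5 : Real.exp (-(x / m)) = Real.exp (-(x / μ k)) * Real.exp ((m / μ k - 1) * (x / m)) := by
    rw [← Real.exp_add]
    congr 1
    field_simp
    ring
  simp_rw [h4]
  rw [intervalIntegral.integral_const_mul, intervalIntegral_exp_mul h3, h5]
  have h6 : m / μ k - 1 = -((μ k - m) / μ k) := by
    field_simp
    ring
  generalize Real.exp ((m / μ k - 1) * (x / m)) = E
  rw [h6]
  field_simp
  ring

section Hypoexponential

variable {Ω : Type*} [MeasurableSpace Ω] {Pr : Measure Ω} {ι : Type*} {μ : ι → ℝ}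
  {g : ι → Ω → ℝ}

/-- A tail is monotone in its level, hence Borel. -/
lemma measurable_measure_le (T : Ω → ℝ) : Measurable fun y : ℝ => Pr {ω | y ≤ T ω} :=
  Antitone.measurable fun _ _ hyz => measure_mono fun _ hω => hyz.trans hω

lemma ae_pos_of_map_eq_expMeasure {Y : Ω → ℝ} (hY : Measurable Y)
    (hlaw : Pr.map Y = expMeasure 1) : ∀ᵐ ω ∂Pr, 0 < Y ω :=
  ae_of_ae_map hY.aemeasurable (hlaw ▸ ae_pos_expMeasure_one)

lemma ae_nonneg_sum_mul {s : Finset ι} (hpos : ∀ i ∈ s, 0 < μ i) (hg : ∀ i, Measurable (g i))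
    (hlaw : ∀ i, Pr.map (g i) = expMeasure 1) : ∀ᵐ ω ∂Pr, 0 ≤ ∑ i ∈ s, μ i * g i ω := by
  have h : ∀ᵐ ω ∂Pr, ∀ i ∈ s, 0 < g i ω :=
    (Finset.eventually_all s).2 fun i _ => ae_pos_of_map_eq_expMeasure (hg i) (hlaw i)
  filter_upwards [h] with ω hω
  exact Finset.sum_nonneg fun i hi => (mul_pos (hpos i hi) (hω i hi)).le

variable [IsProbabilityMeasure Pr]

/-- The tail of the sum of an exponential random variable and an independent one. -/
lemma measureReal_le_mul_add {Y T : Ω → ℝ} (hY : Measurable Y) (hT : Measurable T)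
    (hlaw : Pr.map Y = expMeasure 1) (hind : IndepFun Y T Pr) (m x : ℝ) :
    Pr.real {ω | x ≤ m * Y ω + T ω} =
      ∫ t in Set.Ioi 0, Real.exp (-t) * Pr.real {ω | x - m * t ≤ T ω} := by
  have hS : MeasurableSet {p : ℝ × ℝ | x ≤ m * p.1 + p.2} :=
    measurableSet_le measurable_const (by fun_prop)
  have hT' (t : ℝ) : MeasurableSet {ω | x - m * t ≤ T ω} := measurableSet_le measurable_const hT
  have hmeas : Measurable fun t : ℝ => Pr {ω | x - m * t ≤ T ω} :=
    (measurable_measure_le T).comp (g := fun y : ℝ => Pr {ω | y ≤ T ω}) (by fun_prop)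
  have h1 : Pr {ω | x ≤ m * Y ω + T ω} = ∫⁻ t, Pr {ω | x - m * t ≤ T ω} ∂(expMeasure 1) := by
    have := lintegral_comp_prodMk_of_indepFun hY hT hind
      (F := {p : ℝ × ℝ | x ≤ m * p.1 + p.2}.indicator 1) (measurable_one.indicator hS)
    rw [← hlaw, lintegral_map hmeas hY,
      ← lintegral_indicator_one (measurableSet_le measurable_const (by fun_prop))]
    refine this.trans (lintegral_congr fun ω => ?_)
    rw [← lintegral_indicator_one (hT' _)]
    refine lintegral_congr fun ω' => ?_
    simp only [Set.indicator, Set.mem_ofPred_eq, sub_le_iff_le_add', Pi.one_apply]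
  rw [Measure.real, h1, ← integral_toReal hmeas.aemeasurable
    (Filter.Eventually.of_forall fun t => measure_lt_top _ _), integral_expMeasure_one]
  rfl

/-- The tail of a sum of independent exponential random variables with distinct means. -/
lemma measureReal_le_sum_mul [DecidableEq ι] (hg : ∀ i, Measurable (g i))
    (hlaw : ∀ i, Pr.map (g i) = expMeasure 1) (hind : iIndepFun g Pr) (s : Finset ι)
    (hpos : ∀ i ∈ s, 0 < μ i) (hinj : Set.InjOn μ s) {x : ℝ} (hx : 0 < x) :
    Pr.real {ω | x ≤ ∑ i ∈ s, μ i * g i ω} =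
      ∑ k ∈ s, (∏ j ∈ s.erase k, μ k / (μ k - μ j)) * Real.exp (-(x / μ k)) := by
  induction s using Finset.cons_induction generalizing x with
  -- Positivity of `x` matters here: the empty sum reaches the level `0` with probability one.
  | empty => simp [hx.not_ge]
  | cons a s ha ih =>
    have hpos' : ∀ i ∈ s, 0 < μ i := fun i hi => hpos i (Finset.mem_cons_of_mem hi)
    have hinj' : Set.InjOn μ s := hinj.mono (by simp)
    have hm : 0 < μ a := hpos a (Finset.mem_cons_self a s)
    have hne : ∀ i ∈ s, μ i ≠ μ a := fun i hi h =>
      ha (hinj (Finset.mem_cons_of_mem hi) (Finset.mem_cons_self a s) h ▸ hi)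
    let T : Ω → ℝ := fun ω => ∑ i ∈ s, μ i * g i ω
    have hT : Measurable T := Finset.measurable_fun_sum _ fun i _ => (hg i).const_mul _
    have hindT : IndepFun (g a) T Pr := by
      have h := iIndepFun.indepFun_finsetSum_of_notMem
        (hind.comp (fun i y => μ i * y) fun i => by fun_prop)
        (fun i => (measurable_const_mul (μ i)).comp (hg i)) ha
      have h' := h.symm.comp (φ := fun y => (μ a)⁻¹ * y) (ψ := id) (by fun_prop) measurable_id
      convert h' using 1
      · ext ω
        simp [hm.ne']
      · ext ω
        simp [T]
    have hF : ∀ y, y ≤ 0 → Pr.real {ω | y ≤ T ω} = 1 := by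
      intro y hy
      have h : ∀ᵐ ω ∂Pr, y ≤ T ω := by
        filter_upwards [ae_nonneg_sum_mul hpos' hg hlaw] with ω hω
        exact hy.trans hω
      rw [Measure.real, (prob_compl_eq_zero_iff (measurableSet_le measurable_const hT)).1 h,
        ENNReal.toReal_one]
    -- Beyond `c` the new summand reaches `x` alone, and the rest is almost surely nonnegative,
    -- which contributes `exp (-c)`. Below `c` the induction hypothesis applies to the rest.
    set c := x / μ a with hc
    have hc0 : 0 < c := div_pos hx hm
    have hxc : μ a * c = x := by
      rw [hc]
      field_simp
    have hint : IntegrableOn (fun t => Real.exp (-t) * Pr.real {ω | x - μ a * t ≤ T ω})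
        (Set.Ioi 0) := by
      refine (integrableOn_exp_neg_Ioi 0).mono' ?_ (Filter.Eventually.of_forall fun t => ?_)
      · have h : Measurable fun t : ℝ => Pr.real {ω | x - μ a * t ≤ T ω} :=
          ((measurable_measure_le T).comp (by fun_prop)).ennreal_toReal
        exact (Measurable.mul (by fun_prop) h).aestronglyMeasurable
      · rw [Real.norm_eq_abs, abs_of_nonneg (by positivity)]
        exact mul_le_of_le_one_right (Real.exp_pos _).le measureReal_le_one
    simp_rw [Finset.sum_cons]
    rw [measureReal_le_mul_add (hg a) hT (hlaw a) hindT, ← Set.Ioc_union_Ioi_eq_Ioi hc0.le,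
      setIntegral_union Set.Ioc_disjoint_Ioi_same measurableSet_Ioi
        (hint.mono_set Set.Ioc_subset_Ioi_self) (hint.mono_set (Set.Ioi_subset_Ioi hc0.le))]
    have h1 : ∫ t in Set.Ioi c, Real.exp (-t) * Pr.real {ω | x - μ a * t ≤ T ω} =
        Real.exp (-c) := by
      rw [← integral_exp_neg_Ioi c]
      refine setIntegral_congr_fun measurableSet_Ioi fun t ht => ?_
      have ht : c < t := ht
      rw [hF _ (by nlinarith), mul_one]
    have h2 : ∫ t in Set.Ioc 0 c, Real.exp (-t) * Pr.real {ω | x - μ a * t ≤ T ω} =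
        ∑ k ∈ s, (∏ j ∈ s.erase k, μ k / (μ k - μ j)) * (μ k / (μ k - μ a)) *
          (Real.exp (-(x / μ k)) - Real.exp (-c)) := by
      -- The endpoint `t = c` is discarded because the remaining level is `0` there, outside the
      -- induction hypothesis.
      rw [← integral_Ioc_exp_neg_mul_sum hm hx hpos' hne, integral_Ioc_eq_integral_Ioo,
        integral_Ioc_eq_integral_Ioo]
      refine setIntegral_congr_fun measurableSet_Ioo fun t ht => ?_
      rw [ih hpos' hinj' (by nlinarith [ht.2])]
    -- The total coefficient of `exp (-c)` is `1` minus the old coefficients, which this identity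
    -- recognises as the product belonging to `a`.
    have h3 := sum_prod_div_sub_eq_one (Finset.cons_nonempty ha) hpos hinj
    have h4 : ∀ k ∈ s, ∏ j ∈ (Finset.cons a s ha).erase k, μ k / (μ k - μ j) =
        (∏ j ∈ s.erase k, μ k / (μ k - μ j)) * (μ k / (μ k - μ a)) := by
      intro k hk
      have hka : a ≠ k := fun h => ha (h ▸ hk)
      rw [Finset.erase_cons_of_ne ha hka, Finset.prod_cons, mul_comm]
    rw [Finset.sum_cons, Finset.sum_congr rfl h4] at h3
    have h5 : ∑ k ∈ s, (∏ j ∈ (Finset.cons a s ha).erase k, μ k / (μ k - μ j)) *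
        Real.exp (-(x / μ k)) = ∑ k ∈ s, (∏ j ∈ s.erase k, μ k / (μ k - μ j)) *
        (μ k / (μ k - μ a)) * Real.exp (-(x / μ k)) :=
      Finset.sum_congr rfl fun k hk => by rw [h4 k hk]
    rw [h1, h2, h5, eq_sub_of_add_eq h3]
    simp only [mul_sub, Finset.sum_sub_distrib, ← Finset.sum_mul]
    ring

end Hypoexponential

/-! ### The outage probability -/

namespace SFNParams

variable {M : ℕ} (N : SFNParams M)

lemma mu_pos (i : Fin M) : 0 < N.mu i := mul_pos (N.P_pos i) (Real.rpow_pos_of_pos (N.d_pos i) _)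

/-- The useful signal is a linear combination of the fading coefficients. -/
lemma signal_eq (y : Fin M → ℝ) :
    ∑ i, N.P i * y i * N.d i ^ (-N.αL) = ∑ i, N.mu i * y i :=
  Finset.sum_congr rfl fun i _ => by rw [mu]; ring

/-- Each `μ_j⁻¹` with `j ≠ k` is absorbed into the corresponding factor of `Dhat`, and `μ_k⁻¹`
cancels its leading `μ_k`; what remains is the hypoexponential coefficient times the noise factor.
-/
lemma prod_inv_mul_Dhat (hmu : Function.Injective N.mu) (θ : ℝ) (k : Fin M) :
    (∏ j, (N.mu j)⁻¹) * N.Dhat θ k =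
      (∏ j ∈ Finset.univ.erase k, N.mu k / (N.mu k - N.mu j)) *
        Real.exp (-((N.mu k)⁻¹ * θ * N.W / (N.GS * N.GR))) := by
  have hk := N.mu_pos k
  have h : ∀ j ∈ Finset.univ.erase k, (N.mu j)⁻¹ * (1 / N.mu j - 1 / N.mu k)⁻¹ =
      N.mu k / (N.mu k - N.mu j) := by
    intro j hj
    have hj0 := N.mu_pos j
    have h1 : N.mu k - N.mu j ≠ 0 := sub_ne_zero.2 (hmu.ne (Finset.ne_of_mem_erase hj).symm)
    have h2 : 1 / N.mu j - 1 / N.mu k = (N.mu k - N.mu j) / (N.mu j * N.mu k) := by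
      field_simp
    rw [h2]
    field_simp
  rw [← Finset.prod_congr rfl h, Finset.prod_mul_distrib, Dhat,
    ← Finset.mul_prod_erase Finset.univ (fun j => (N.mu j)⁻¹) (Finset.mem_univ k)]
  field_simp

end SFNParams

namespace IsSFNNetwork

variable {Ω : Type*} [MeasurableSpace Ω] {Pr : Measure Ω} {M : ℕ}
  {N : SFNParams M} {X : ℕ → Ω → Plane} {los : ℕ → Ω → Bool} {h : ℕ → Ω → ℝ}
  {g : Fin M → Ω → ℝ}

/-- This excludes the quotient `0 / 0` in the SINR and makes truncation by `ENNReal.ofReal`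
harmless. -/
lemma ae_signal_pos [Nonempty (Fin M)] (hN : IsSFNNetwork N Pr X los h g) :
    ∀ᵐ ω ∂Pr, 0 < ∑ i, N.mu i * g i ω := by
  have h : ∀ᵐ ω ∂Pr, ∀ i, 0 < g i ω :=
    ae_all_iff.2 fun i => ae_pos_of_map_eq_expMeasure (hN.g_measurable i) (hN.g_law i)
  filter_upwards [h] with ω hω
  exact Finset.sum_pos (fun i _ => mul_pos (N.mu_pos i) (hω i)) Finset.univ_nonempty

lemma measurable_measure_mul_add_le_signal (N : SFNParams M) (g : Fin M → Ω → ℝ) (θ : ℝ) :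
    Measurable fun y : ℝ≥0∞ => Pr {ω | ENNReal.ofReal θ * (ENNReal.ofReal N.W + y) ≤
      ENNReal.ofReal (N.GS * N.GR * ∑ i, N.mu i * g i ω)} :=
  Antitone.measurable fun y z hyz => measure_mono fun ω hω =>
    le_trans (by gcongr) (show ENNReal.ofReal θ * (ENNReal.ofReal N.W + z) ≤ _ from hω)

variable [IsProbabilityMeasure Pr]

/-- The tail of the useful signal. -/
lemma measureReal_le_signal [Nonempty (Fin M)] (hN : IsSFNNetwork N Pr X los h g)
    (hmu : Function.Injective N.mu) {x : ℝ} (hx : 0 ≤ x) :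
    Pr.real {ω | x ≤ ∑ i, N.mu i * g i ω} =
      ∑ k, (∏ j ∈ Finset.univ.erase k, N.mu k / (N.mu k - N.mu j)) *
        Real.exp (-(x / N.mu k)) := by
  -- The level `0` occurs when noise and interference both vanish; both sides are then `1`.
  rcases hx.eq_or_lt with rfl | hx
  · have h1 := ae_nonneg_sum_mul (s := Finset.univ) (fun i _ => N.mu_pos i) hN.g_measurable hN.g_law
    have hm : MeasurableSet {ω | 0 ≤ ∑ i, N.mu i * g i ω} :=
      measurableSet_le measurable_const
        (Finset.measurable_fun_sum _ fun i _ => (hN.g_measurable i).const_mul _)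
    rw [Measure.real, (prob_compl_eq_zero_iff hm).1 h1, ENNReal.toReal_one,
      ← sum_prod_div_sub_eq_one Finset.univ_nonempty (fun i _ => N.mu_pos i) hmu.injOn]
    simp
  · exact measureReal_le_sum_mul hN.g_measurable hN.g_law hN.g_indep Finset.univ
      (fun i _ => N.mu_pos i) hmu.injOn hx

/-- The probability that the signal exceeds a multiple of noise plus interference, given the
interference. -/
lemma measure_le_signal_eq_lintegral (hN : IsSFNNetwork N Pr X los h g) (θ : ℝ) :
    Pr {ω | ENNReal.ofReal θ * (ENNReal.ofReal N.W + N.interference X los h ω) ≤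
        ENNReal.ofReal (N.GS * N.GR * ∑ i, N.mu i * g i ω)} =
      ∫⁻ ω, Pr {ω' | ENNReal.ofReal θ * (ENNReal.ofReal N.W + N.interference X los h ω) ≤
        ENNReal.ofReal (N.GS * N.GR * ∑ i, N.mu i * g i ω')} ∂Pr := by
  let H : ℝ≥0∞ → ℝ≥0∞ := fun y => Pr {ω' | ENNReal.ofReal θ * (ENNReal.ofReal N.W + y) ≤
    ENNReal.ofReal (N.GS * N.GR * ∑ i, N.mu i * g i ω')}
  have hH : Measurable H := measurable_measure_mul_add_le_signal N g θ
  have hI : Measurable fun p : (ℕ → Plane) × (ℕ → Bool) × (ℕ → ℝ) × (Fin M → ℝ) =>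
      N.interferenceAt p.1 p.2.1 p.2.2.1 :=
    N.measurable_interferenceAt.comp
      (f := fun p : (ℕ → Plane) × (ℕ → Bool) × (ℕ → ℝ) × (Fin M → ℝ) =>
        (p.1, p.2.1, p.2.2.1)) (by fun_prop)
  let S : Set ((ℕ → Plane) × (ℕ → Bool) × (ℕ → ℝ) × (Fin M → ℝ)) :=
    {p | ENNReal.ofReal θ * (ENNReal.ofReal N.W + N.interferenceAt p.1 p.2.1 p.2.2.1) ≤
      ENNReal.ofReal (N.GS * N.GR * ∑ i, N.mu i * p.2.2.2 i)}
  have hS : MeasurableSet S := measurableSet_le (by fun_prop) (by fun_prop)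
  have hg := hN.g_measurable
  have hIm := hN.measurable_interference
  -- Both sides become iterated integrals over points, marks, fading and signal. The innermost
  -- integral of the indicator is `H` at the interference, which no longer depends on the signal.
  have h1 := hN.lintegral_comp (F := S.indicator 1) (measurable_one.indicator hS)
  have h2 := hN.lintegral_comp (F := fun p => H (N.interferenceAt p.1 p.2.1 p.2.2.1))
    (hH.comp hI)
  rw [← lintegral_indicator_one (measurableSet_le (by fun_prop) (by fun_prop))]
  refine h1.trans (Eq.trans ?_ h2.symm)
  refine lintegral_congr fun ω₁ => lintegral_congr fun ω₂ => lintegral_congr fun ω₃ => ?_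
  have h3 (c : ℝ≥0∞) : ∫⁻ _, c ∂Pr = c := by simp
  refine Eq.trans ?_
    (h3 (H (N.interferenceAt (fun j => X j ω₁) (fun j => los j ω₂) fun j => h j ω₃))).symm
  have hm : Measurable fun ω₄ =>
      ((fun j => X j ω₁, fun j => los j ω₂, fun j => h j ω₃, fun i => g i ω₄) :
        (ℕ → Plane) × (ℕ → Bool) × (ℕ → ℝ) × (Fin M → ℝ)) := by fun_prop
  exact lintegral_indicator_one (hm hS)

/-- The conditional probability of the signal exceeding a multiple of noise plus interference. -/
lemma measureReal_le_signal_of_interference [Nonempty (Fin M)] (hN : IsSFNNetwork N Pr X los h g)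
    (hmu : Function.Injective N.mu) {θ : ℝ} (hθ : 0 < θ) (y : ℝ≥0∞) :
    Pr.real {ω | ENNReal.ofReal θ * (ENNReal.ofReal N.W + y) ≤
        ENNReal.ofReal (N.GS * N.GR * ∑ i, N.mu i * g i ω)} =
      ∑ k, (∏ j, (N.mu j)⁻¹) * N.Dhat θ k * (if y = ∞ then 0 else
        Real.exp (-((N.mu k)⁻¹ * θ / (N.GS * N.GR) * y.toReal))) := by
  have hG : 0 < N.GS * N.GR := mul_pos N.GS_pos N.GR_pos
  rcases eq_or_ne y ∞ with rfl | hy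
  -- Infinite interference cannot be matched by the finite signal, so both sides are `0`.
  · simp [ENNReal.mul_top, hθ]
  have hy0 : 0 ≤ y.toReal := ENNReal.toReal_nonneg
  have hev : Pr.real {ω | ENNReal.ofReal θ * (ENNReal.ofReal N.W + y) ≤
      ENNReal.ofReal (N.GS * N.GR * ∑ i, N.mu i * g i ω)} =
      Pr.real {ω | θ * (N.W + y.toReal) / (N.GS * N.GR) ≤ ∑ i, N.mu i * g i ω} := by
    refine measureReal_congr ?_
    filter_upwards [hN.ae_signal_pos] with ω hω
    refine propext ?_
    change _ ≤ _ ↔ _ ≤ _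
    rw [div_le_iff₀' hG, ← ENNReal.ofReal_le_ofReal_iff (mul_pos hG hω).le,
      ENNReal.ofReal_mul hθ.le, ENNReal.ofReal_add N.W_nonneg hy0, ENNReal.ofReal_toReal hy]
  have hx : 0 ≤ θ * (N.W + y.toReal) / (N.GS * N.GR) :=
    div_nonneg (mul_nonneg hθ.le (add_nonneg N.W_nonneg hy0)) hG.le
  rw [hev, hN.measureReal_le_signal hmu hx]
  refine Finset.sum_congr rfl fun k _ => ?_
  rw [if_neg hy, N.prod_inv_mul_Dhat hmu, mul_assoc, ← Real.exp_add]
  congr 2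
  have := N.mu_pos k
  field_simp
  ring

/-- The outage probability in terms of the Laplace transform of the interference. -/
theorem outageProb_eq (hN : IsSFNNetwork N Pr X los h g) (hmu : Function.Injective N.mu) {θ : ℝ}
    (hθ : 0 < θ) :
    N.outageProb Pr X los h g θ =
      1 - (∏ j, (N.mu j)⁻¹) * ∑ k, N.Dhat θ k *
        laplaceTransform Pr (N.interference X los h) ((N.mu k)⁻¹ * θ / (N.GS * N.GR)) := by
  rcases isEmpty_or_nonempty (Fin M) with hM | hM
  -- Without SFN stations the SINR is `0`, so outage is certain and the sum is empty.
  · simp [SFNParams.outageProb, SFNParams.sinr, hθ]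
  have hG : 0 < N.GS * N.GR := mul_pos N.GS_pos N.GR_pos
  have hg := hN.g_measurable
  have hIm := hN.measurable_interference
  let E : Set Ω := {ω | ENNReal.ofReal θ * (ENNReal.ofReal N.W + N.interference X los h ω) ≤
    ENNReal.ofReal (N.GS * N.GR * ∑ i, N.mu i * g i ω)}
  have hE : MeasurableSet E := measurableSet_le (by fun_prop) (by fun_prop)
  have hout : N.outageProb Pr X los h g θ = Pr.real Eᶜ := by
    refine measureReal_congr ?_
    filter_upwards [hN.ae_signal_pos] with ω hω
    refine propext ?_
    change N.sinr X los h g ω < ENNReal.ofReal θ ↔ ¬ (_ ≤ ENNReal.ofReal _)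
    have hpos : ENNReal.ofReal (N.GS * N.GR * ∑ i, N.mu i * g i ω) ≠ 0 :=
      (ENNReal.ofReal_pos.2 (mul_pos hG hω)).ne'
    rw [SFNParams.sinr, N.signal_eq fun i => g i ω, not_le,
      ENNReal.div_lt_iff (Or.inr hpos) (Or.inr ENNReal.ofReal_ne_top)]
  have hterm (k : Fin M) : Integrable (fun ω => if N.interference X los h ω = ∞ then 0 else
      Real.exp (-((N.mu k)⁻¹ * θ / (N.GS * N.GR) * (N.interference X los h ω).toReal))) Pr := by
    refine Integrable.of_bound (C := 1) ?_ (Filter.Eventually.of_forall fun ω => ?_)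
    · exact (Measurable.ite (hIm (measurableSet_singleton _)) measurable_const
        (by fun_prop)).aestronglyMeasurable
    · split_ifs
      · simp
      · rw [Real.norm_eq_abs, Real.abs_exp, Real.exp_le_one_iff, neg_nonpos]
        have := N.mu_pos k
        positivity
  rw [hout, probReal_compl_eq_one_sub hE]
  congr 1
  calc Pr.real E
      = ∫ ω, Pr.real {ω' | ENNReal.ofReal θ *
          (ENNReal.ofReal N.W + N.interference X los h ω) ≤
          ENNReal.ofReal (N.GS * N.GR * ∑ i, N.mu i * g i ω')} ∂Pr := by
        rw [Measure.real, hN.measure_le_signal_eq_lintegral θ, ← integral_toReal ?_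
          (Filter.Eventually.of_forall fun ω => measure_lt_top _ _)]
        · rfl
        · exact ((measurable_measure_mul_add_le_signal N g θ).comp hIm).aemeasurable
    _ = _ := by
        simp_rw [hN.measureReal_le_signal_of_interference hmu hθ]
        rw [integral_finsetSum _ fun k _ => (hterm k).const_mul _, Finset.mul_sum]
        refine Finset.sum_congr rfl fun k _ => ?_
        rw [integral_const_mul, laplaceTransform, mul_assoc]

end IsSFNNetwork

theorem corollary1 {Ω : Type*} [MeasurableSpace Ω] (Pr : Measure Ω) [IsProbabilityMeasure Pr]
    {M : ℕ} (N : SFNParams M)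
    (X : ℕ → Ω → Plane) (los : ℕ → Ω → Bool) (h : ℕ → Ω → ℝ) (g : Fin M → Ω → ℝ)
    (hN : IsSFNNetwork N Pr X los h g)
    (hmu : ∀ i j : Fin M, i ≠ j → N.mu i ≠ N.mu j)
    (θ : ℝ) (hθ : 0 < θ) :
    N.outageProb Pr X los h g θ =
        1 - (∏ j, (N.mu j)⁻¹) * ∑ k, N.Dhat θ k *
          laplaceTransform Pr (N.interference X los h) ((N.mu k)⁻¹ * θ / (N.GS * N.GR)) ∧
      (2 < N.αL → 2 < N.αN → ∀ s : ℝ, 0 < s →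
        laplaceTransform Pr (N.interference X los h) s =
          N.laplaceFactor (N.pL * N.lam) N.αL s *
            N.laplaceFactor ((1 - N.pL) * N.lam) N.αN s) :=
  ⟨hN.outageProb_eq (fun i j hij => by_contra fun hne => hmu i j hne hij) hθ,
    fun hL hNL _ hs => hN.laplaceTransform_interference hL hNL hs⟩
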